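/- For $t\in\mathbb R$ let $$\phi(t)=\sum_{k\in\mathbb Z}\frac{e^{-4\pi^2ik^2t}-1}{-4\pi^2k^2},$$ where the term $k=0$ is understood as its limit $it$. Let $$Y_1(h)=\sum_{k=1}^\infty \frac{e^{ik^2/(4h)}}{k^2},\qquad t_{p,q}=\frac{p/q}{2\pi}.$$ For $h\in\mathbb R$ let $h^{1/2}$ be the nonnegative square root if $h\ge 0$ and $h^{1/2}=-i|h|^{1/2}$ if $h<0$, and let $h^{3/2}=(h^{1/2})^3$. There is an absolute constant $C>0$ such that the following holds. Let $p,q$ be integers with $0\le p<q$, $\gcd(p,q)=1$ and $q\equiv 0,1,3\pmod 4$, and write $2p/q=\tilde p/\tilde q$ in lowest terms with $\tilde q>0$. Call an integer $c$ admissible if there is an integer $d$ such that $z\mapsto(\tilde q z-\tilde p)/(cz+d)$ belongs to the $\theta$-modular group, that is, $\tilde q d+\tilde p c=1$ and $\tilde q\equiv d\not\equiv \tilde p\equiv c\pmod 2$. Then there are admissible $c_+,c_-$ with $\tilde q\le c_+\le 4\tilde q$ and $-4\tilde q\le c_-\le-\tilde q$, and there is $e_{p,q}\in\mathbb C$, depending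 only on $p$ and $q$, with $e_{p,q}^8=1$, such that for every such choice of $c_+$ and $c_-$, with $c_\pm=c_+$ for $h\ge0$, $c_\pm=c_-$ for $h<0$, and $$b(h)=\frac{\tilde q^2h}{1+4\pi c_\pm\tilde q h},$$ the following three expansions hold. (1) For all real $h$ with $|h|\le \dfrac{1}{4\pi\frac{|c_\pm|}{\tilde q}\tilde q^2}$, $$\phi(t_{p,q}+h)-\phi(t_{p,q})=\frac{e_{p,q}}{\sqrt\pi}\frac{1+i}{\sqrt2}\left(\frac{h^{1/2}}{\tilde q^{1/2}}+4i\,Y_1(b(h))\,\tilde q^{3/2}h^{3/2}+R\right),\qquad |R|\le C\,\tilde q^{7/2}|h|^{5/2}.$$ (2) For the same $h$, $$\phi(t_{p,q}+h)-\phi(t_{p,q})=\frac32\frac{e_{p,q}}{\sqrt\pi}\frac{1+i}{\sqrt2}\left[\frac{h^{1/2}}{\tilde q^{1/2}}+\frac{8\pi^2}{3}i\left(\frac16-\frac{i}{2\pi}\frac{c_\pm}{\tilde q}-2\phi\!\left(\frac{-1}{16\pi^2b(h)}\right)\right)\tilde q^{3/2}h^{3/2}+R\right],\qquad |R|\le C\,\tilde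 q^{7/2}|h|^{5/2}.$$ (3) For all real $h$ with $|h|\le \dfrac{1}{4\pi\frac{|c_\pm|}{\tilde q}}$, with $\beta(h)=b(h/\tilde q^2)$, $$\phi\!\left(t_{p,q}+\frac h{\tilde q^2}\right)-\phi(t_{p,q})=\frac{3}{2\sqrt\pi}\frac{1+i}{\sqrt2}\frac{e_{p,q}}{\tilde q^{3/2}}\left[h^{1/2}+\frac{8\pi^2}{3}i\left(\frac16-\frac{i}{2\pi}\frac{c_\pm}{\tilde q}-2\phi\!\left(\frac{-1}{16\pi^2\beta(h)}\right)\right)h^{3/2}+R\right],\qquad |R|\le C|h|^{5/2}.$$ At $h=0$ the terms containing $h^{3/2}$ are read as $0$. -/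

import Mathlib

/-- Riemann's non-differentiable function
`φ(t) = ∑_{k ∈ ℤ} (exp(-4π² i k² t) - 1) / (-4π² k²)`,
where the term `k = 0` is understood as its limit value `i t`. -/
noncomputable def riemannPhi (t : ℝ) : ℂ :=
  ∑' k : ℤ, if k = 0 then Complex.I * (t : ℂ) else
    (Complex.exp (-4 * (Real.pi : ℂ) ^ 2 * Complex.I * (k : ℂ) ^ 2 * (t : ℂ)) - 1) /
      (-4 * (Real.pi : ℂ) ^ 2 * (k : ℂ) ^ 2)

/-- The time `t_{p,q} = (p/q) / (2π)`. -/
noncomputable def tRat (p q : ℕ) : ℝ := ((p : ℝ) / (q : ℝ)) / (2 * Real.pi)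

/-- The numerator of `2p/q` in lowest terms. -/
def pTilde (p q : ℕ) : ℤ := (2 * (p : ℚ) / (q : ℚ)).num

/-- The denominator of `2p/q` in lowest terms. -/
def qTilde (p q : ℕ) : ℕ := (2 * (p : ℚ) / (q : ℚ)).den

/-- `Y₁(h) = ∑_{k ≥ 1} exp(i k² / (4h)) / k²` (the summation index is shifted by one). -/
noncomputable def Y₁ (h : ℝ) : ℂ :=
  ∑' k : ℕ, Complex.exp (Complex.I * ((k : ℂ) + 1) ^ 2 / (4 * (h : ℂ))) / ((k : ℂ) + 1) ^ 2

/-- The square root `h^{1/2}` of a real number, with the branch `√(-1) = -i`.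
The power `h^{3/2}` is `(sqrtBranch h) ^ 3`. -/
noncomputable def sqrtBranch (h : ℝ) : ℂ :=
  if 0 ≤ h then ((Real.sqrt h : ℝ) : ℂ) else -Complex.I * ((Real.sqrt (-h) : ℝ) : ℂ)

/-- The integers `a, b, c, d` are the coefficients of an element
`z ↦ (a z + b) / (c z + d)` of the `θ`-modular group: `ad - bc = 1` and
`a ≡ d ≢ b ≡ c (mod 2)`. -/
def IsThetaModular (a b c d : ℤ) : Prop :=
  a * d - b * c = 1 ∧ a ≡ d [ZMOD 2] ∧ b ≡ c [ZMOD 2] ∧ ¬ a ≡ b [ZMOD 2]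

/-- `c` is the lower left coefficient of a `θ`-modular transformation
`z ↦ (q̃ z - p̃) / (c z + d)`, which sends `p̃/q̃ = 2p/q` to `0`. -/
def IsLowerCoeff (p q : ℕ) (c : ℤ) : Prop :=
  ∃ d : ℤ, IsThetaModular (qTilde p q : ℤ) (-pTilde p q) c d

/-- Admissible values of `c₊`: lower coefficients with `q̃ ≤ c₊ ≤ 4 q̃`. -/
def IsCPlus (p q : ℕ) (c : ℤ) : Prop :=
  IsLowerCoeff p q c ∧ (qTilde p q : ℤ) ≤ c ∧ c ≤ 4 * (qTilde p q : ℤ)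

/-- Admissible values of `c₋`: lower coefficients with `-4 q̃ ≤ c₋ ≤ -q̃`. -/
def IsCMinus (p q : ℕ) (c : ℤ) : Prop :=
  IsLowerCoeff p q c ∧ -(4 * (qTilde p q : ℤ)) ≤ c ∧ c ≤ -(qTilde p q : ℤ)

/-- `c_±`: the value `c₊` for `h ≥ 0` and `c₋` for `h < 0`. -/
noncomputable def cPM (cp cm : ℤ) (h : ℝ) : ℝ := if 0 ≤ h then (cp : ℝ) else (cm : ℝ)

/-- The rescaling `b(h) = q̃² h / (1 + 4π c_± q̃ h)`. -/
noncomputable def bScale (p q : ℕ) (cp cm : ℤ) (h : ℝ) : ℝ :=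
  (qTilde p q : ℝ) ^ 2 * h / (1 + 4 * Real.pi * cPM cp cm h * (qTilde p q : ℝ) * h)

/-- `β(h) = b(h / q̃²)`. -/
noncomputable def betaScale (p q : ℕ) (cp cm : ℤ) (h : ℝ) : ℝ :=
  bScale p q cp cm (h / (qTilde p q : ℝ) ^ 2)

/-! Increments of φ are, up to conjugation and the factor i/(4π), increments along the real line of
a primitive of Jacobi's θ, and 4π t_{p,q} is the cusp x = p̃/q̃. Since q is not 2 mod 4, p̃ and q̃
have opposite parity, so x is equivalent to ∞ under the theta group: θ(-κ - 1/(q̃²w)) = e (-i q̃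
w)^{1/2} θ(x + w) with κ = c/q̃ and e⁸ = 1 (`jacobiTheta_cusp`, `exists_jacobiTheta_tilde`).
Admissible values of c differ by multiples of 2q̃ and θ has period 2, hence e depends on the cusp
only.

Solving for θ(x + w) and integrating by parts twice, with the primitives ∑ exp(πik²z)/k^{2m} of the
theta series, gives a term in w^{1/2}, a term in w^{3/2} carrying `thetaPrim 1` (which is Y₁), and a
remainder whose derivative is O(q̃^{7/2}|w|^{3/2}) because `thetaPrim 2` is bounded up to the real
line (`hasDerivAt_cuspExpansion`, `norm_thetaInt_sub_cuspExpansion_le`). This is form (1).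

For form (2), Y₁(b) is itself φ at -1/(16π²b) plus a term linear in 1/b (`Y₁_eq_riemannPhi`). As 1/b
= 1/(q̃²h) + 4πκ, that linear term adds half of the leading h^{1/2} term, whence the factor 3/2, and
a constant in κ. Form (3) is (2) at h/q̃². -/

/-! ### Transformation of θ under the theta group -/

open Complex in
/-- Möbius transformations with real coefficients of determinant one preserve the upper half
plane. -/
theorem moebius_im_pos {a b c d : ℤ} (hdet : a * d - b * c = 1) {z : ℂ} (hz : 0 < z.im) :
    (c : ℂ) * z + d ≠ 0 ∧ 0 < (((a : ℂ) * z + b) / (c * z + d)).im := by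
  have hne : (c : ℂ) * z + d ≠ 0 := by
    intro h
    have h1 := congrArg Complex.im h
    have h2 := congrArg Complex.re h
    simp [hz.ne'] at h1
    subst h1
    simp at h2
    subst h2
    simp at hdet
  refine ⟨hne, ?_⟩
  have hdet' : (a : ℝ) * d - b * c = 1 := by exact_mod_cast hdet
  have : (((a : ℂ) * z + b) / (c * z + d)).im = z.im / normSq ((c : ℂ) * z + d) := by
    rw [Complex.div_im]
    simp only [Complex.add_re, Complex.mul_re, Complex.intCast_re, Complex.intCast_im, zero_mul,
      sub_zero, Complex.add_im, Complex.mul_im, add_zero]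
    rw [← sub_div]
    congr 1
    linear_combination z.im * hdet'
  rw [this]
  exact div_pos hz (normSq_pos.2 hne)

theorem jacobiTheta_add_two_mul_int (z : ℂ) (n : ℤ) : jacobiTheta (z + n * 2) = jacobiTheta z :=
  Function.Periodic.int_mul (c := (2 : ℂ))
    (fun x => by rw [add_comm]; exact jacobiTheta_two_add x) n z

theorem jacobiTheta_neg_inv {z : ℂ} (hz : 0 < z.im) :
    jacobiTheta (-1 / z) = (-Complex.I * z) ^ (1 / 2 : ℂ) * jacobiTheta z := by
  have := jacobiTheta_S_smul ⟨z, hz⟩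
  rw [UpperHalfPlane.modular_S_smul, UpperHalfPlane.coe_mk, UpperHalfPlane.coe_mk] at this
  rw [← this, neg_div, one_div, inv_neg]

theorem cpow_half_sq (w : ℂ) : (w ^ (1 / 2 : ℂ)) ^ 2 = w := by
  rw [← Complex.cpow_nat_mul]; norm_num

theorem neg_I_mul_mem_slitPlane {z : ℂ} (hz : 0 < z.im) : -Complex.I * z ∈ Complex.slitPlane := by
  rw [Complex.mem_slitPlane_iff]; left; simpa using hz

/-- Transformation law of `θ` under the theta group, with a continuous automorphy factor. -/
theorem jacobiTheta_moebius (a b c d : ℤ) (hdet : a * d - b * c = 1) (hac : Odd (a + c))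
    (hbd : Odd (b + d)) :
    ∃ g : ℂ → ℂ, ContinuousOn g {z | 0 < z.im} ∧ ∀ z : ℂ, 0 < z.im →
      g z ^ 8 = ((c : ℂ) * z + d) ^ 4 ∧
      jacobiTheta (((a : ℂ) * z + b) / (c * z + d)) = g z * jacobiTheta z := by
  induction hn : c.natAbs using Nat.strong_induction_on generalizing a b c d with
  | _ n ih =>
  by_cases hc : c = 0
  · subst hc
    have had : a * d = 1 := by linarith
    have hd : (d : ℂ) = a ∧ (a : ℂ) * a = 1 := by
      rcases Int.mul_eq_one_iff_eq_one_or_neg_one.1 had with ⟨rfl, rfl⟩ | ⟨rfl, rfl⟩ <;> simp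
    have hb : Even b := by
      rcases Int.mul_eq_one_iff_eq_one_or_neg_one.1 had with ⟨rfl, rfl⟩ | ⟨rfl, rfl⟩ <;>
        (rw [Int.odd_iff] at hbd; rw [Int.even_iff]; omega)
    obtain ⟨m, rfl⟩ := hb
    refine ⟨fun _ => 1, continuousOn_const, fun z _ => ⟨?_, ?_⟩⟩
    · rw [hd.1]; push_cast; linear_combination -((a : ℂ) * a + 1) * hd.2
    · have ha0 : (a : ℂ) ≠ 0 := fun h => by simp [h] at hd
      rw [one_mul, ← jacobiTheta_add_two_mul_int z (a * m)]
      congr 1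
      rw [hd.1]; push_cast
      rw [zero_mul, zero_add, div_eq_mul_inv, inv_eq_of_mul_eq_one_left hd.2]
      linear_combination z * hd.2
  -- Euclidean step: subtracting 2k from the image reduces a modulo 2c to a balanced residue, and z
  -- ↦ -1/z then makes -a' the lower left entry. The inequality is strict because |a'| = |c| would
  -- make a + c even.
  · obtain ⟨k, a', ha, hlt⟩ : ∃ k a' : ℤ, a = a' + 2 * c * k ∧ a'.natAbs < c.natAbs := by
      -- `Int.bmod` is taken with the positive modulus 2|c|; the sign of c converts the quotient
      -- back to a multiple of 2c.
      refine ⟨a.bdiv (2 * c.natAbs) * c.sign, a.bmod (2 * c.natAbs), ?_, ?_⟩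
      · have h := Int.bmod_add_bdiv a (2 * c.natAbs)
        have h3 : c * c.sign = c.natAbs := by rw [Int.mul_sign_self]
        push_cast at h h3 ⊢
        linear_combination -h - 2 * a.bdiv (2 * c.natAbs) * h3
      · have hpos : 0 < 2 * c.natAbs := by omega
        have h1 := Int.bmod_le (x := a) hpos
        have h2 := Int.le_bmod (x := a) hpos
        have h := Int.bmod_add_bdiv a (2 * c.natAbs)
        have h4 : (((2 * c.natAbs : ℕ) : ℤ)) * a.bdiv (2 * c.natAbs)
            = 2 * ((c.natAbs : ℤ) * a.bdiv (2 * c.natAbs)) := by push_cast; ring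
        rw [h4] at h
        rw [Int.odd_iff] at hac
        omega
    obtain ⟨g, hgc, hg⟩ := ih a'.natAbs (hn ▸ hlt) c d (-a') (-(b - 2 * d * k))
      (by subst ha; linear_combination hdet)
      (by subst ha; rw [Int.odd_iff] at hac ⊢
          have : a' + 2 * c * k + c = a' + c + 2 * (c * k) := by ring
          omega)
      (by rw [Int.odd_iff] at hbd ⊢
          have : d + -(b - 2 * d * k) = d - b + 2 * (d * k) := by ring
          omega) (by simp)
    have hdet2 : c * (-(b - 2 * d * k)) - d * (-a') = 1 := by subst ha; linear_combination hdet
    refine ⟨fun z => (-Complex.I * ((c * z + d) / ((-a' : ℤ) * z + (-(b - 2 * d * k) : ℤ)))) ^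
      (1 / 2 : ℂ) * g z, ?_, fun z hz => ?_⟩
    · refine ContinuousOn.mul (ContinuousOn.cpow_const ?_ ?_) hgc
      · refine continuousOn_const.mul (ContinuousOn.div (by fun_prop) (by fun_prop) ?_)
        exact fun z hz => (moebius_im_pos hdet2 hz).1
      · exact fun z hz => neg_I_mul_mem_slitPlane (moebius_im_pos hdet2 hz).2
    · obtain ⟨hne, him⟩ := moebius_im_pos hdet2 hz
      have hne2 := (moebius_im_pos hdet hz).1
      obtain ⟨h1, h2⟩ := hg z hz
      constructor
      · rw [mul_pow, h1]
        rw [show 8 = 2 * 4 from rfl, pow_mul, cpow_half_sq, mul_pow, div_pow]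
        rw [show (-Complex.I) ^ 4 = 1 by rw [neg_pow]; norm_num]
        rw [one_mul, div_mul_cancel₀ _ (pow_ne_zero _ hne)]
      · rw [mul_assoc, ← h2, ← jacobiTheta_neg_inv him, ← jacobiTheta_add_two_mul_int _ (-k)]
        congr 1
        subst ha
        push_cast at hne ⊢
        field_simp
        ring

/-- On the upper half plane `θ` at the image point differs from `θ(z)` by a fixed eighth root of
unity and the principal root `(-i(qz - p))^{1/2}`. -/
theorem jacobiTheta_cusp {p q c d : ℤ} (hq : 0 < q) (hdet : q * d + p * c = 1)
    (hqc : Odd (q + c)) (hpd : Odd (p + d)) :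
    ∃ e : ℂ, e ^ 8 = 1 ∧ ∀ z : ℂ, 0 < z.im →
      jacobiTheta (-(c / q) - 1 / (q * (q * z - p))) =
        e * (-Complex.I * (q * z - p)) ^ (1 / 2 : ℂ) * jacobiTheta z := by
  have hdet' : (-c) * (-p) - (-d) * q = 1 := by linear_combination hdet
  -- The theta transformation sending p/q to 0, followed by z ↦ -1/z, so that p/q goes to ∞.
  obtain ⟨g, hgc, hg⟩ := jacobiTheta_moebius (-c) (-d) q (-p) hdet'
    (by rw [Int.odd_iff] at *; omega) (by rw [Int.odd_iff] at *; omega)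
  have hq' : (q : ℂ) ≠ 0 := by exact_mod_cast hq.ne'
  have hmem : ∀ z : ℂ, 0 < z.im → -Complex.I * (q * z - p) ∈ Complex.slitPlane := by
    intro z hz
    apply neg_I_mul_mem_slitPlane
    have : 0 < (q : ℝ) := by exact_mod_cast hq
    simpa using mul_pos this hz
  have hroot : ∀ z : ℂ, 0 < z.im → (-Complex.I * (q * z - p)) ^ (1 / 2 : ℂ) ≠ 0 := by
    intro z hz h
    rw [Complex.cpow_eq_zero_iff] at h
    exact Complex.slitPlane_ne_zero (hmem z hz) h.1
  have hT : Set.Finite {x : ℂ | x ^ 8 = 1} := by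
    have : {x : ℂ | x ^ 8 = 1} = ((Polynomial.nthRootsFinset 8 (1 : ℂ) : Finset ℂ) : Set ℂ) := by
      ext x; simp
    rw [this]; exact Finset.finite_toSet _
  have hconv : IsPreconnected {z : ℂ | 0 < z.im} :=
    (convex_halfSpace_im_gt 0).isPreconnected
  -- The quotient of the automorphy factor by the principal root is continuous with values in the
  -- finite set of eighth roots of unity, hence constant on the connected half plane.
  obtain ⟨e, he, hconst⟩ := hconv.eqOn_const_of_mapsTo hT.isDiscrete
    (f := fun z => g z / (-Complex.I * (q * z - p)) ^ (1 / 2 : ℂ))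
    (hgc.div (ContinuousOn.cpow_const (by fun_prop) hmem) hroot)
    (by
      intro z hz
      have h8 : ((-Complex.I * (q * z - p)) ^ (1 / 2 : ℂ)) ^ 8 = (q * z - p) ^ 4 := by
        rw [show 8 = 2 * 4 from rfl, pow_mul, cpow_half_sq, mul_pow,
          show (-Complex.I) ^ 4 = 1 by rw [neg_pow]; norm_num, one_mul]
      have h0 := pow_ne_zero 8 (hroot z hz)
      rw [Set.mem_ofPred_eq, div_pow, div_eq_one_iff_eq h0, h8, (hg z hz).1]
      push_cast; ring)
    ⟨1, by simp⟩
  refine ⟨e, he, fun z hz => ?_⟩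
  have h1 : g z / (-Complex.I * (q * z - p)) ^ (1 / 2 : ℂ) = e := hconst hz
  rw [div_eq_iff (hroot z hz)] at h1
  rw [← h1, ← (hg z hz).2]
  congr 1
  have hne := (moebius_im_pos hdet' hz).1
  have hdc : (q : ℂ) * d + p * c = 1 := by exact_mod_cast hdet
  push_cast at hne ⊢
  simp only [← sub_eq_add_neg] at hne ⊢
  rw [eq_div_iff hne, sub_mul, neg_mul, div_mul_eq_mul_div, div_mul_eq_mul_div, one_mul,
    div_mul_cancel_right₀ hne, ← neg_div, ← one_div, ← sub_div, div_eq_iff hq']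
  linear_combination hdc

/-! ### Parity of the cusp and admissible lower coefficients -/

/-- The parity claim uses q ≢ 2 mod 4. Both p̃, q̃ even contradicts coprimality. If both are odd,
p̃q = 2pq̃ makes q even, hence divisible by 4, and then p is even too, against gcd(p, q) = 1. -/
theorem tilde_spec {p q : ℕ} (hpq : p < q) (hgcd : Nat.gcd p q = 1)
    (hmod : q % 4 = 0 ∨ q % 4 = 1 ∨ q % 4 = 3) :
    0 < qTilde p q ∧ IsCoprime (qTilde p q : ℤ) (pTilde p q) ∧
      Odd ((qTilde p q : ℤ) + pTilde p q) ∧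
      (pTilde p q : ℝ) / (qTilde p q : ℝ) = 2 * ((p : ℝ) / q) := by
  have hden : 0 < qTilde p q := Rat.den_pos _
  have hcop : IsCoprime (qTilde p q : ℤ) (pTilde p q) := by
    rw [Int.isCoprime_iff_gcd_eq_one, Int.gcd_comm]
    exact (2 * (p : ℚ) / (q : ℚ)).reduced
  have hdiv : (pTilde p q : ℚ) / (qTilde p q : ℚ) = 2 * (p : ℚ) / q := Rat.num_div_den _
  have hq0 : 0 < q := by omega
  refine ⟨hden, hcop, ?_, ?_⟩
  · have hq : (q : ℚ) ≠ 0 := by exact_mod_cast hq0.ne'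
    have hQ : (qTilde p q : ℚ) ≠ 0 := by exact_mod_cast hden.ne'
    rw [div_eq_div_iff hQ hq] at hdiv
    have hz : pTilde p q * (q : ℤ) = 2 * p * qTilde p q := by exact_mod_cast hdiv
    have hpq2 : IsCoprime (q : ℤ) (p : ℤ) := by
      rw [Nat.isCoprime_iff_coprime, Nat.coprime_comm]; exact hgcd
    by_contra hodd
    rw [Int.not_odd_iff_even] at hodd
    have hnot : ¬ ((2 : ℤ) ∣ qTilde p q ∧ (2 : ℤ) ∣ pTilde p q) := by
      rintro ⟨h1, h2⟩
      have := hcop.isUnit_of_dvd' h1 h2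
      rw [Int.isUnit_iff] at this
      omega
    have hnot' : ¬ ((2 : ℤ) ∣ q ∧ (2 : ℤ) ∣ p) := by
      rintro ⟨h1, h2⟩
      have := hpq2.isUnit_of_dvd' h1 h2
      rw [Int.isUnit_iff] at this
      omega
    obtain ⟨x, hx⟩ : Odd (qTilde p q : ℤ) := by
      rw [Int.odd_iff]; rw [Int.even_iff] at hodd; omega
    obtain ⟨y, hy⟩ : Odd (pTilde p q) := by
      rw [Int.odd_iff]; rw [Int.even_iff] at hodd; omega
    rw [hx, hy] at hz
    have h1 : 2 * (y * q) + q = 2 * (p * (2 * x + 1)) := by linear_combination hz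
    obtain ⟨r, hr⟩ : ∃ r : ℤ, (q : ℤ) = 4 * r := ⟨q / 4, by omega⟩
    rw [hr] at h1
    have h0 : y * (4 * r) + 2 * r = p * (2 * x + 1) := by linarith
    have h2 : (p : ℤ) = 2 * (2 * (y * r) + r - p * x) := by linear_combination -h0
    exact hnot' ⟨⟨2 * r, by linear_combination hr⟩, ⟨_, h2⟩⟩
  · have := congrArg (fun x : ℚ => (x : ℝ)) hdiv
    push_cast at this
    rw [this]; ring

theorem isLowerCoeff_iff {p q : ℕ} {c : ℤ} :
    IsLowerCoeff p q c ↔ ∃ d : ℤ, (qTilde p q : ℤ) * d + pTilde p q * c = 1 ∧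
      (qTilde p q : ℤ) ≡ d [ZMOD 2] ∧ pTilde p q ≡ c [ZMOD 2] ∧
      ¬ (qTilde p q : ℤ) ≡ pTilde p q [ZMOD 2] := by
  unfold IsLowerCoeff IsThetaModular
  refine exists_congr fun d => ?_
  simp only [Int.ModEq, neg_mul, sub_neg_eq_add]
  constructor <;> rintro ⟨h1, h2, h3, h4⟩ <;> refine ⟨h1, h2, ?_, ?_⟩ <;> omega

/-- A Bézout pair (c, d) can be moved by (Q, -P), which repairs the parities since exactly one of P,
Q is odd. Moves by (2Q, -2P) then preserve admissibility, so every window of length 2Q is hit. -/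
theorem exists_isLowerCoeff_mem_Ico {p q : ℕ} (hq : 0 < qTilde p q)
    (hcop : IsCoprime (qTilde p q : ℤ) (pTilde p q))
    (hodd : Odd ((qTilde p q : ℤ) + pTilde p q)) (m : ℤ) :
    ∃ c : ℤ, IsLowerCoeff p q c ∧ m ≤ c ∧ c < m + 2 * (qTilde p q : ℤ) := by
  simp only [isLowerCoeff_iff]
  set Q : ℤ := (qTilde p q : ℤ)
  set P := pTilde p q
  have hQ : 0 < Q := Int.natCast_pos.2 hq
  obtain ⟨d₀, c₀, h₀⟩ := hcop
  rw [Int.odd_iff] at hodd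
  obtain ⟨c₁, d₁, h₁, hd₁, hc₁⟩ : ∃ c d : ℤ, Q * d + P * c = 1 ∧ Q % 2 = d % 2 ∧ P % 2 = c % 2 := by
    rcases Int.even_or_odd' Q with ⟨x, hx | hx⟩ <;> rcases Int.even_or_odd' P with ⟨y, hy | hy⟩
    · omega
    · have hc : c₀ % 2 = 1 := by
        have : 2 * (d₀ * x) + 2 * (c₀ * y) + c₀ = 1 := by
          rw [hx, hy] at h₀; linear_combination h₀
        omega
      rcases Int.even_or_odd' d₀ with ⟨w, hw | hw⟩
      · exact ⟨c₀, d₀, by linear_combination h₀, by omega, by omega⟩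
      · exact ⟨c₀ + Q, d₀ - P, by linear_combination h₀, by omega, by omega⟩
    · have hd : d₀ % 2 = 1 := by
        have : 2 * (d₀ * x) + d₀ + 2 * (c₀ * y) = 1 := by
          rw [hx, hy] at h₀; linear_combination h₀
        omega
      rcases Int.even_or_odd' c₀ with ⟨w, hw | hw⟩
      · exact ⟨c₀, d₀, by linear_combination h₀, by omega, by omega⟩
      · exact ⟨c₀ + Q, d₀ - P, by linear_combination h₀, by omega, by omega⟩
    · omega
  set k := (c₁ - m) / (2 * Q)
  have hk := Int.emod_add_mul_ediv (c₁ - m) (2 * Q)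
  have h0 := Int.emod_nonneg (c₁ - m) (b := 2 * Q) (by omega)
  have h2 := Int.emod_lt_of_pos (c₁ - m) (b := 2 * Q) (by omega)
  refine ⟨c₁ - 2 * (Q * k), ⟨d₁ + 2 * (P * k), ?_, ?_, ?_, ?_⟩, ?_, ?_⟩
  · linear_combination h₁
  · simp only [Int.ModEq]; omega
  · simp only [Int.ModEq]; omega
  · simp only [Int.ModEq]; omega
  · have : 2 * Q * ((c₁ - m) / (2 * Q)) = 2 * (Q * k) := by ring
    omega
  · have : 2 * Q * ((c₁ - m) / (2 * Q)) = 2 * (Q * k) := by ring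
    omega

/-- Two Bézout pairs differ by m(Q, -P); an odd m would change the parity of c or d, one of P, Q
being odd. -/
theorem IsLowerCoeff.exists_sub_eq {p q : ℕ} (hq : 0 < qTilde p q) {c c' : ℤ}
    (hc : IsLowerCoeff p q c) (hc' : IsLowerCoeff p q c') :
    ∃ k : ℤ, c' = c + 2 * k * (qTilde p q : ℤ) := by
  rw [isLowerCoeff_iff] at hc hc'
  obtain ⟨d, h1, h2, h3, h4⟩ := hc
  obtain ⟨d', h1', h2', h3', -⟩ := hc'
  set Q : ℤ := (qTilde p q : ℤ)
  set P := pTilde p q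
  have hQ : Q ≠ 0 := (Int.natCast_pos.2 hq).ne'
  simp only [Int.ModEq] at *
  have hm : c' - c = Q * (d * (c' - c) - c * (d' - d)) := by
    linear_combination (-(c' - c)) * h1 + c * (h1' - h1)
  have hm' : d' - d = -(P * (d * (c' - c) - c * (d' - d))) := by
    apply mul_left_cancel₀ hQ
    linear_combination h1' - h1 - P * hm
  set m := d * (c' - c) - c * (d' - d)
  obtain ⟨k, hk⟩ : Even m := by
    rcases Int.even_or_odd' m with ⟨w, hw | hw⟩
    · exact ⟨w, by omega⟩
    · exfalso
      rw [hw] at hm hm'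
      have e1 : c' - c = 2 * (Q * w) + Q := by linear_combination hm
      have e2 : d' - d = -(2 * (P * w) + P) := by linear_combination hm'
      omega
  exact ⟨k, by rw [hk] at hm; linear_combination hm⟩

/-! ### Primitives of the theta series -/

/-- The iterated primitives `∑_{k ≥ 1} exp(π i k² z) / k^{2m}` of the theta series. -/
noncomputable def thetaPrim (m : ℕ) (z : ℂ) : ℂ :=
  ∑' k : ℕ, Complex.exp (Real.pi * Complex.I * ((k : ℂ) + 1) ^ 2 * z) / (((k : ℂ) + 1) ^ 2) ^ m

theorem norm_natCast_add_one_sq (k : ℕ) : ‖((k : ℂ) + 1) ^ 2‖ = ((k : ℝ) + 1) ^ 2 := by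
  rw [norm_pow]
  congr 1
  exact_mod_cast Complex.norm_natCast (k + 1)

theorem hasSum_inv_add_one_sq :
    HasSum (fun k : ℕ => 1 / ((k : ℝ) + 1) ^ 2) (Real.pi ^ 2 / 6) := by
  have := (hasSum_nat_add_iff' 1).2 hasSum_zeta_two
  simpa using this

/-- A majorant independent of z on the closed half plane; it yields boundedness and continuity up to
the real line, and termwise differentiation inside. -/
theorem norm_thetaPrim_term_le (m : ℕ) (k : ℕ) {z : ℂ} (hz : 0 ≤ z.im) :
    ‖Complex.exp (Real.pi * Complex.I * ((k : ℂ) + 1) ^ 2 * z) / (((k : ℂ) + 1) ^ 2) ^ (m + 1)‖ ≤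
      1 / ((k : ℝ) + 1) ^ 2 := by
  rw [norm_div, norm_pow, norm_natCast_add_one_sq, Complex.norm_exp]
  have hre : (Real.pi * Complex.I * ((k : ℂ) + 1) ^ 2 * z).re
      = -(Real.pi * ((k : ℝ) + 1) ^ 2 * z.im) := by
    have : (Real.pi * Complex.I * ((k : ℂ) + 1) ^ 2 * z)
      = ((Real.pi * ((k : ℝ) + 1) ^ 2 : ℝ) : ℂ) * (Complex.I * z) := by push_cast; ring
    rw [this, Complex.re_ofReal_mul]; simp
  have h1 : (1 : ℝ) ≤ ((k : ℝ) + 1) ^ 2 := one_le_pow₀ (by linarith [k.cast_nonneg (α := ℝ)])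
  apply div_le_div₀ zero_le_one _ (by positivity)
  · exact le_self_pow₀ h1 (Nat.succ_ne_zero m)
  · rw [hre]; exact Real.exp_le_one_iff.2 (neg_nonpos.2 (by positivity))

theorem norm_thetaPrim_le (m : ℕ) {z : ℂ} (hz : 0 ≤ z.im) : ‖thetaPrim (m + 1) z‖ ≤ 2 := by
  refine (tsum_of_norm_bounded hasSum_inv_add_one_sq fun k => norm_thetaPrim_term_le m k hz).trans ?_
  nlinarith [Real.pi_pos, Real.pi_lt_d2]

theorem continuousOn_thetaPrim (m : ℕ) : ContinuousOn (thetaPrim (m + 1)) {z | 0 ≤ z.im} := by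
  refine continuousOn_tsum (fun k => ?_) hasSum_inv_add_one_sq.summable
    fun k z hz => norm_thetaPrim_term_le m k hz
  fun_prop

theorem hasDerivAt_thetaPrim (m : ℕ) {z : ℂ} (hz : 0 < z.im) :
    HasDerivAt (thetaPrim (m + 1)) (Real.pi * Complex.I * thetaPrim m z) z := by
  have hopen : IsOpen {z : ℂ | 0 < z.im} := isOpen_lt continuous_const Complex.continuous_im
  have hd : ∀ k : ℕ, Differentiable ℂ fun z : ℂ =>
      Complex.exp (Real.pi * Complex.I * ((k : ℂ) + 1) ^ 2 * z) / (((k : ℂ) + 1) ^ 2) ^ (m + 1) :=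
    fun k => by fun_prop
  have hle : ∀ (k : ℕ) (w : ℂ), w ∈ {z : ℂ | 0 < z.im} → _ :=
    fun k w hw => norm_thetaPrim_term_le m k (le_of_lt hw)
  have hs := hasSum_inv_add_one_sq.summable
  have hdiff := Complex.differentiableOn_tsum_of_summable_norm hs
    (fun k => (hd k).differentiableOn) hopen hle
  have hsum := Complex.hasSum_deriv_of_summable_norm hs
    (fun k => (hd k).differentiableOn) hopen hle hz
  have hderiv := (hdiff.differentiableAt (hopen.mem_nhds hz)).hasDerivAt
  rw [← hsum.tsum_eq] at hderiv
  refine hderiv.congr_deriv ?_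
  rw [thetaPrim, ← tsum_mul_left]
  refine tsum_congr fun k => ?_
  have hk : ((k : ℂ) + 1) ≠ 0 := Nat.cast_add_one_ne_zero k
  have h := (((hasDerivAt_id z).const_mul (Real.pi * Complex.I * ((k : ℂ) + 1) ^ 2)).cexp).div_const
    ((((k : ℂ) + 1) ^ 2) ^ (m + 1))
  simp only [id] at h
  rw [h.deriv, pow_succ]
  field_simp
  ring

theorem thetaPrim_zero {z : ℂ} (hz : 0 < z.im) : 2 * thetaPrim 0 z = jacobiTheta z - 1 := by
  have := (hasSum_nat_jacobiTheta hz).tsum_eq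
  simp only [thetaPrim, pow_zero, div_one]
  rw [this]; ring

/-- A primitive of `θ`, continuous up to the real line. -/
noncomputable def thetaInt (z : ℂ) : ℂ := z + 2 / (Real.pi * Complex.I) * thetaPrim 1 z

theorem hasDerivAt_thetaInt {z : ℂ} (hz : 0 < z.im) :
    HasDerivAt thetaInt (jacobiTheta z) z := by
  refine ((hasDerivAt_id z).add ((hasDerivAt_thetaPrim 0 hz).const_mul _)).congr_deriv ?_
  have hpi : (Real.pi : ℂ) ≠ 0 := by exact_mod_cast Real.pi_ne_zero
  have := thetaPrim_zero hz
  field_simp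
  linear_combination this

theorem continuousOn_thetaInt : ContinuousOn thetaInt {z | 0 ≤ z.im} :=
  continuousOn_id.add (continuousOn_const.mul (continuousOn_thetaPrim 0))

/-! ### Integration by parts at a cusp -/

/-- The image `-κ - 1/(q² w)` of a point at distance `w` from the cusp. -/
noncomputable def cuspMap (q κ : ℝ) (w : ℂ) : ℂ := -κ - 1 / ((q : ℂ) ^ 2 * w)

/-- The principal square root `(-i q w)^{1/2}`. -/
noncomputable def cuspRoot (q : ℝ) (w : ℂ) : ℂ := (-Complex.I * (q * w)) ^ (1 / 2 : ℂ)

/-- The expansion of the primitive of `θ` at a cusp up to order three. -/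
noncomputable def cuspExpansion (q κ : ℝ) (w : ℂ) : ℂ :=
  Complex.I / q * cuspRoot q w *
    (2 + 2 * ((q : ℂ) ^ 2 / (Real.pi * Complex.I)) * w * thetaPrim 1 (cuspMap q κ w)
      + 3 * (q : ℂ) ^ 4 / (Real.pi : ℂ) ^ 2 * w ^ 2 * thetaPrim 2 (cuspMap q κ w))

section
variable {q κ : ℝ} {w : ℂ}

theorem cuspMap_im (w : ℂ) : (cuspMap q κ w).im = w.im / (q ^ 2 * Complex.normSq w) := by
  have : (q : ℂ) ^ 2 * w = ((q ^ 2 : ℝ) : ℂ) * w := by push_cast; ring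
  rw [cuspMap, this, one_div, mul_inv, ← Complex.ofReal_inv, Complex.sub_im, Complex.im_ofReal_mul,
    Complex.inv_im]
  simp only [Complex.neg_im, Complex.ofReal_im]
  rw [div_eq_mul_inv, div_eq_mul_inv, mul_inv]; ring

theorem cuspMap_im_pos (hq : 0 < q) (hw : 0 < w.im) : 0 < (cuspMap q κ w).im := by
  have : w ≠ 0 := fun h => by simp [h] at hw
  rw [cuspMap_im]
  exact div_pos hw (mul_pos (by positivity) (Complex.normSq_pos.2 this))

theorem cuspMap_im_nonneg (hw : 0 ≤ w.im) : 0 ≤ (cuspMap q κ w).im := by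
  rw [cuspMap_im]
  exact div_nonneg hw (mul_nonneg (by positivity) (Complex.normSq_nonneg _))

theorem cuspRoot_sq (w : ℂ) : cuspRoot q w ^ 2 = -Complex.I * (q * w) := cpow_half_sq _

theorem norm_cuspRoot (hq : 0 < q) (w : ℂ) : ‖cuspRoot q w‖ = √q * √‖w‖ := by
  rw [← Real.sqrt_mul hq.le, eq_comm, Real.sqrt_eq_iff_mul_self_eq (by positivity) (norm_nonneg _),
    ← pow_two, ← norm_pow, cuspRoot_sq]
  simp [abs_of_pos hq]

theorem hasDerivAt_cuspRoot (hq : 0 < q) (hw : 0 < w.im) :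
    HasDerivAt (cuspRoot q) (cuspRoot q w / (2 * w)) w := by
  have hw0 : w ≠ 0 := fun h => by simp [h] at hw
  have hq0 : (q : ℂ) ≠ 0 := by exact_mod_cast hq.ne'
  have hmem : -Complex.I * (q * w) ∈ Complex.slitPlane :=
    neg_I_mul_mem_slitPlane (by simpa using mul_pos hq hw)
  have h : HasDerivAt (fun w : ℂ => -Complex.I * (q * w)) (-Complex.I * q) w := by
    simpa using ((hasDerivAt_id w).const_mul (q : ℂ)).const_mul (-Complex.I)
  refine (h.cpow_const (c := 1 / 2) hmem).congr_deriv ?_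
  rw [Complex.cpow_sub _ _ (Complex.slitPlane_ne_zero hmem), Complex.cpow_one, cuspRoot]
  have := Complex.I_ne_zero
  field_simp

theorem continuousOn_cuspRoot (hq : 0 < q) : ContinuousOn (cuspRoot q) {w | 0 ≤ w.im} := by
  intro w hw
  refine ContinuousAt.continuousWithinAt ?_
  have h : ContinuousAt (fun w : ℂ => -Complex.I * (q * w)) w := by fun_prop
  refine ContinuousAt.comp (g := fun x : ℂ => x ^ (1 / 2 : ℂ))
    (Complex.continuousAt_cpow_const_of_re_pos (Or.inl ?_) (by norm_num)) h
  simpa using mul_nonneg hq.le hw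

theorem hasDerivAt_cuspMap (hq : 0 < q) (hw : w ≠ 0) :
    HasDerivAt (cuspMap q κ) (1 / ((q : ℂ) ^ 2 * w ^ 2)) w := by
  have hq0 : (q : ℂ) ≠ 0 := by exact_mod_cast hq.ne'
  have h := ((((hasDerivAt_id w).const_mul ((q : ℂ) ^ 2)).inv
    (mul_ne_zero (pow_ne_zero 2 hq0) hw))).const_sub (-κ : ℂ)
  simp only [← one_div, id] at h
  refine h.congr_deriv ?_
  field_simp

theorem continuousOn_cuspExpansion (hq : 0 < q) :
    ContinuousOn (cuspExpansion q κ) {w | 0 ≤ w.im ∧ w ≠ 0} := by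
  have hu : ContinuousOn (cuspMap q κ) {w | 0 ≤ w.im ∧ w ≠ 0} := fun w hw =>
    (hasDerivAt_cuspMap hq hw.2).continuousAt.continuousWithinAt
  have hm : Set.MapsTo (cuspMap q κ) {w | 0 ≤ w.im ∧ w ≠ 0} {z | 0 ≤ z.im} := fun w hw =>
    cuspMap_im_nonneg hw.1
  have h1 := (continuousOn_thetaPrim 0).comp hu hm
  have h2 := (continuousOn_thetaPrim 1).comp hu hm
  have hsub : {w : ℂ | 0 ≤ w.im ∧ w ≠ 0} ⊆ {w | 0 ≤ w.im} := fun w hw => hw.1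
  have h3 := (continuousOn_cuspRoot hq).mono hsub
  simp only [Function.comp_def, Nat.reduceAdd, zero_add] at h1 h2
  unfold cuspExpansion
  fun_prop

/-- The coefficients 2, 2, 3 come from integrating w^{-1/2} θ by parts twice: the `thetaPrim 1`
contributions cancel, and 15/2 = 3 · 5/2 is left from differentiating w^{5/2}. -/
theorem hasDerivAt_cuspExpansion (hq : 0 < q) (hw : 0 < w.im) :
    HasDerivAt (cuspExpansion q κ)
      (Complex.I / q * cuspRoot q w / w * (jacobiTheta (cuspMap q κ w)
        + 15 / 2 * (q : ℂ) ^ 4 / (Real.pi : ℂ) ^ 2 * w ^ 2 * thetaPrim 2 (cuspMap q κ w))) w := by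
  have hw0 : w ≠ 0 := fun h => by simp [h] at hw
  have hq0 : (q : ℂ) ≠ 0 := by exact_mod_cast hq.ne'
  have hpi : (Real.pi : ℂ) ≠ 0 := by exact_mod_cast Real.pi_ne_zero
  have hI := Complex.I_ne_zero
  have hu := cuspMap_im_pos (κ := κ) hq hw
  have hcm := hasDerivAt_cuspMap (κ := κ) hq hw0
  have h1 := (hasDerivAt_thetaPrim 0 hu).comp w hcm
  have h2 := (hasDerivAt_thetaPrim 1 hu).comp w hcm
  have hA := ((hasDerivAt_id w).const_mul (2 * ((q : ℂ) ^ 2 / (Real.pi * Complex.I)))).mul h1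
  have hB := ((hasDerivAt_pow 2 w).const_mul (3 * (q : ℂ) ^ 4 / (Real.pi : ℂ) ^ 2)).mul h2
  have h := ((hasDerivAt_cuspRoot hq hw).const_mul (Complex.I / q)).mul ((hA.const_add 2).add hB)
  refine h.congr_deriv ?_
  rw [show jacobiTheta (cuspMap q κ w) = 2 * thetaPrim 0 (cuspMap q κ w) + 1 by
    rw [thetaPrim_zero hu]; ring]
  simp only [Function.comp_apply, id, Nat.reduceAdd, zero_add, Pi.add_apply, Pi.mul_apply]
  generalize thetaPrim 0 (cuspMap q κ w) = T0
  generalize thetaPrim 1 (cuspMap q κ w) = T1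
  generalize thetaPrim 2 (cuspMap q κ w) = T2
  generalize cuspRoot q w = S
  have hI2 := Complex.I_sq
  field_simp
  ring_nf
  simp only [hI2]
  ring
end

/-! ### Error estimate up to the real line -/

section
open Filter Topology
variable {q κ : ℝ}

theorem norm_thetaPrim_two_term_le (hq : 0 < q) {w : ℂ} (hw : 0 ≤ w.im) :
    ‖3 * (q : ℂ) ^ 4 / (Real.pi : ℂ) ^ 2 * w ^ 2 * thetaPrim 2 (cuspMap q κ w)‖
      ≤ q ^ 4 * ‖w‖ ^ 2 := by
  have hT := norm_thetaPrim_le 1 (cuspMap_im_nonneg (q := q) (κ := κ) hw)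
  have hpi : 3 / Real.pi ^ 2 * 2 ≤ 1 := by
    rw [div_mul_eq_mul_div, div_le_one (by positivity)]
    nlinarith [Real.pi_gt_three]
  rw [norm_mul, norm_mul, norm_div, norm_mul, norm_pow, norm_pow, norm_pow, Complex.norm_real,
    Complex.norm_real, Real.norm_of_nonneg hq.le, Real.norm_of_nonneg Real.pi_pos.le,
    Complex.norm_ofNat]
  calc 3 * q ^ 4 / Real.pi ^ 2 * ‖w‖ ^ 2 * ‖thetaPrim 2 (cuspMap q κ w)‖
      ≤ 3 * q ^ 4 / Real.pi ^ 2 * ‖w‖ ^ 2 * 2 := by gcongr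
    _ = (3 / Real.pi ^ 2 * 2) * (q ^ 4 * ‖w‖ ^ 2) := by ring
    _ ≤ 1 * (q ^ 4 * ‖w‖ ^ 2) := by gcongr
    _ = _ := one_mul _

/-- `cuspMap` has no limit at 0, but the theta primitives stay bounded and the root factor tends to
0. -/
theorem tendsto_cuspExpansion_zero (hq : 0 < q) :
    Tendsto (fun ε : ℝ => cuspExpansion q κ (Complex.I * ε)) (𝓝[>] 0) (𝓝 0) := by
  have hI : Tendsto (fun ε : ℝ => Complex.I * (ε : ℂ)) (𝓝[>] 0) (𝓝[{w | 0 ≤ w.im}] 0) := by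
    refine tendsto_nhdsWithin_iff.2 ⟨?_, ?_⟩
    · have : Continuous fun ε : ℝ => Complex.I * (ε : ℂ) := by fun_prop
      simpa using (this.tendsto 0).mono_left nhdsWithin_le_nhds
    · filter_upwards [self_mem_nhdsWithin] with ε hε
      simpa using le_of_lt hε
  have hroot : Tendsto (fun ε : ℝ => Complex.I / q * cuspRoot q (Complex.I * ε)) (𝓝[>] 0) (𝓝 0) := by
    have h0 : cuspRoot q 0 = 0 := by simp [cuspRoot]
    have := (continuousOn_cuspRoot hq 0 (by simp)).tendsto.comp hI
    rw [h0] at this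
    simpa using this.const_mul (Complex.I / q)
  refine hroot.zero_mul_isBoundedUnder_le ?_
  refine isBoundedUnder_of_eventually_le (a := 2 + 2 * (q ^ 2 / Real.pi) * 2 + q ^ 4) ?_
  filter_upwards [Ioc_mem_nhdsGT one_pos] with ε hε
  have hn : ‖Complex.I * (ε : ℂ)‖ = ε := by simp [abs_of_pos hε.1]
  have him : 0 ≤ (Complex.I * (ε : ℂ)).im := by simpa using hε.1.le
  have hT := norm_thetaPrim_le 0 (cuspMap_im_nonneg (q := q) (κ := κ) him)
  refine (norm_add_le _ _).trans (add_le_add ((norm_add_le _ _).trans (add_le_add (by simp) ?_)) ?_)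
  · rw [norm_mul, norm_mul, hn]
    have : ‖2 * ((q : ℂ) ^ 2 / (Real.pi * Complex.I))‖ = 2 * (q ^ 2 / Real.pi) := by
      simp [abs_of_pos Real.pi_pos]
    rw [this]
    calc 2 * (q ^ 2 / Real.pi) * ε * _ ≤ 2 * (q ^ 2 / Real.pi) * 1 * 2 := by
          gcongr
          exact hε.2
      _ = _ := by ring
  · refine (norm_thetaPrim_two_term_le hq him).trans ?_
    rw [hn]
    have : ε ^ 2 ≤ 1 := pow_le_one₀ hε.1.le hε.2
    nlinarith [pow_pos hq 4]

/-- Expansion of the primitive of `θ` along the real line near a cusp. -/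
theorem norm_thetaInt_sub_cuspExpansion_le (hq : 0 < q) {x : ℝ} {e : ℂ} (he : ‖e‖ = 1)
    (hid : ∀ z : ℂ, 0 < z.im →
      jacobiTheta (cuspMap q κ (z - x)) = e * cuspRoot q (z - x) * jacobiTheta z)
    {h : ℝ} (hh : h ≠ 0) :
    ‖thetaInt (x + h) - thetaInt x - e⁻¹ * cuspExpansion q κ h‖ ≤ 10 * q ^ 3 * √q * (h ^ 2 * √|h|) := by
  have he0 : e ≠ 0 := fun h => by simp [h] at he
  have hq0 : (q : ℂ) ≠ 0 := by exact_mod_cast hq.ne'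
  set D : ℂ → ℂ := fun w => thetaInt (x + w) - e⁻¹ * cuspExpansion q κ w
  -- Only the residue of the integration by parts survives in the derivative of D, the θ terms
  -- cancelling by the transformation law.
  set D' : ℂ → ℂ := fun w => -(e⁻¹ * (Complex.I / q * cuspRoot q w / w *
    (15 / 2 * (q : ℂ) ^ 4 / (Real.pi : ℂ) ^ 2 * w ^ 2 * thetaPrim 2 (cuspMap q κ w))))
  have hD : ∀ w : ℂ, 0 < w.im → HasDerivAt D (D' w) w := by
    intro w hw
    have hw0 : w ≠ 0 := fun h => by simp [h] at hw
    have hxw : 0 < ((x : ℂ) + w).im := by simpa using hw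
    have h1 := HasDerivAt.comp_const_add (x : ℂ) w (hasDerivAt_thetaInt hxw)
    refine (h1.sub ((hasDerivAt_cuspExpansion (κ := κ) hq hw).const_mul e⁻¹)).congr_deriv ?_
    have h2 := hid _ hxw
    rw [add_sub_cancel_left] at h2
    rw [h2]
    have h3 := cuspRoot_sq (q := q) w
    have h4 : e⁻¹ * (Complex.I / q * cuspRoot q w / w * (e * cuspRoot q w * jacobiTheta (x + w)))
        = jacobiTheta (x + w) := by
      have : e⁻¹ * (Complex.I / q * cuspRoot q w / w * (e * cuspRoot q w * jacobiTheta (x + w)))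
        = (e⁻¹ * e) * (Complex.I / q / w * cuspRoot q w ^ 2) * jacobiTheta (x + w) := by ring
      rw [this, h3, inv_mul_cancel₀ he0, one_mul]
      have h5 : Complex.I / q / w * (-Complex.I * (q * w)) = 1 := by
        field_simp; rw [Complex.I_sq]; ring
      rw [h5, one_mul]
    rw [mul_add, mul_add, h4, sub_add_cancel_left]
  -- Large enough for the segment from iε to h + iε, with ε < |h|, to lie in the ball.
  set ρ := 2 * |h|
  have hρ : 0 < |h| := abs_pos.2 hh
  set s : Set ℂ := {w | 0 < w.im} ∩ Metric.ball 0 ρ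
  have hconv : Convex ℝ s := (convex_halfSpace_im_gt 0).inter (convex_ball 0 ρ)
  have hbound : ∀ w ∈ s, ‖D' w‖ ≤ 5 / 2 * (q ^ 3 * √q * (ρ * √ρ)) := by
    rintro w ⟨hw, hwρ⟩
    have hw0 : w ≠ 0 := fun h => by simp [h] at hw
    have hwn : ‖w‖ ≤ ρ := (mem_ball_zero_iff.1 hwρ).le
    have hT := norm_thetaPrim_two_term_le (κ := κ) hq (le_of_lt hw)
    have hsplit : D' w = -(e⁻¹ * (5 / 2 * (Complex.I / q * cuspRoot q w / w) *
        (3 * (q : ℂ) ^ 4 / (Real.pi : ℂ) ^ 2 * w ^ 2 * thetaPrim 2 (cuspMap q κ w)))) := by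
      simp only [D']; ring
    have hw1 : 0 < ‖w‖ := norm_pos_iff.2 hw0
    have hX : ‖Complex.I / q * cuspRoot q w / w‖ = 1 / q * (√q * √‖w‖) / ‖w‖ := by
      rw [norm_div, norm_mul, norm_div, Complex.norm_I, norm_cuspRoot hq, Complex.norm_real,
        Real.norm_of_nonneg hq.le]
    rw [hsplit, norm_neg, norm_mul, norm_inv, he, inv_one, one_mul, norm_mul, norm_mul _ (_ / w), hX]
    calc _ ≤ ‖(5 / 2 : ℂ)‖ * (1 / q * (√q * √‖w‖) / ‖w‖) * (q ^ 4 * ‖w‖ ^ 2) := by gcongr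
      _ = 5 / 2 * (q ^ 3 * √q * (‖w‖ * √‖w‖)) := by
        have : ‖(5 / 2 : ℂ)‖ = 5 / 2 := by norm_num
        rw [this]; field_simp
      _ ≤ _ := by gcongr
  -- Mean value inequality at height ε, where everything is holomorphic; ε → 0 follows.
  have hmain : ∀ ε : ℝ, 0 < ε → ε < |h| →
      ‖D (h + Complex.I * ε) - D (Complex.I * ε)‖ ≤ 5 / 2 * (q ^ 3 * √q * (ρ * √ρ)) * |h| := by
    intro ε h0 h1
    have hn : ‖Complex.I * (ε : ℂ)‖ = ε := by simp [abs_of_pos h0]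
    have hm1 : Complex.I * (ε : ℂ) ∈ s := by
      refine ⟨by simpa using h0, ?_⟩
      rw [mem_ball_zero_iff, hn]; linarith
    have hm2 : (h : ℂ) + Complex.I * (ε : ℂ) ∈ s := by
      refine ⟨by simpa using h0, ?_⟩
      rw [mem_ball_zero_iff]
      refine (norm_add_le _ _).trans_lt ?_
      rw [hn, Complex.norm_real, Real.norm_eq_abs]; linarith
    have := hconv.norm_image_sub_le_of_norm_hasDerivWithin_le
      (fun w hw => (hD w hw.1).hasDerivWithinAt) hbound hm1 hm2
    rwa [add_sub_cancel_right, Complex.norm_real, Real.norm_eq_abs] at this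
  have hto : ∀ y : ℝ, Tendsto (fun ε : ℝ => (y : ℂ) + Complex.I * (ε : ℂ)) (𝓝[>] 0)
      (𝓝[{w | 0 < w.im}] y) := by
    intro y
    refine tendsto_nhdsWithin_iff.2 ⟨?_, ?_⟩
    · have : Continuous fun ε : ℝ => (y : ℂ) + Complex.I * (ε : ℂ) := by fun_prop
      simpa using (this.tendsto 0).mono_left nhdsWithin_le_nhds
    · filter_upwards [self_mem_nhdsWithin] with ε hε
      simpa using hε
  have hsub : {w : ℂ | 0 < w.im} ⊆ {w | 0 ≤ w.im} := fun w (hw : 0 < w.im) =>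
    show 0 ≤ w.im from hw.le
  have hint : ∀ y : ℝ, Tendsto (fun ε : ℝ => thetaInt (x + (y + Complex.I * (ε : ℂ)))) (𝓝[>] 0)
      (𝓝 (thetaInt (x + y))) := by
    intro y
    have h1 := (continuousOn_thetaInt ((x + y : ℝ) : ℂ) (by simp)).tendsto.comp
      ((hto (x + y)).mono_right (nhdsWithin_mono _ hsub))
    simpa [Function.comp_def, add_assoc] using h1
  have hsub' : {w : ℂ | 0 < w.im} ⊆ {w | 0 ≤ w.im ∧ w ≠ 0} := fun w hw =>
    ⟨hsub hw, fun h0 => by simp [h0] at hw⟩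
  have hexp : Tendsto (fun ε : ℝ => cuspExpansion q κ (h + Complex.I * (ε : ℂ))) (𝓝[>] 0)
      (𝓝 (cuspExpansion q κ h)) :=
    (continuousOn_cuspExpansion hq (h : ℂ) ⟨by simp, by exact_mod_cast hh⟩).tendsto.comp
      ((hto h).mono_right (nhdsWithin_mono _ hsub'))
  have hlim := (((hint h).sub (hexp.const_mul e⁻¹)).sub
    ((by simpa using hint 0 : Tendsto (fun ε : ℝ => thetaInt (x + Complex.I * (ε : ℂ))) (𝓝[>] 0)
      (𝓝 (thetaInt x))).sub ((tendsto_cuspExpansion_zero (κ := κ) hq).const_mul e⁻¹))).norm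
  have hle := le_of_tendsto hlim
    (by filter_upwards [Ioo_mem_nhdsGT hρ] with ε hε using hmain ε hε.1 hε.2)
  rw [mul_zero, sub_zero, sub_right_comm] at hle
  refine hle.trans ?_
  have hs : √ρ ≤ 2 * √|h| := by
    rw [Real.sqrt_le_left (by positivity), mul_pow, Real.sq_sqrt (abs_nonneg h)]
    simp only [ρ]; linarith
  calc 5 / 2 * (q ^ 3 * √q * (ρ * √ρ)) * |h|
      ≤ 5 / 2 * (q ^ 3 * √q * (ρ * (2 * √|h|))) * |h| := by gcongr
    _ = 10 * (q ^ 3 * √q * (|h| ^ 2 * √|h|)) := by simp only [ρ]; ring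
    _ = _ := by rw [sq_abs]; ring
end

/-! ### From θ to φ -/

section
open scoped ComplexConjugate

theorem conj_thetaPrim (m : ℕ) (x : ℝ) : conj (thetaPrim m x) = thetaPrim m (-x) := by
  rw [thetaPrim, thetaPrim, Complex.conj_tsum]
  refine tsum_congr fun k => ?_
  simp [← Complex.exp_conj]

theorem Y₁_eq (b : ℝ) : Y₁ b = thetaPrim 1 (1 / (4 * Real.pi * b)) := by
  have hpi : (Real.pi : ℂ) ≠ 0 := by exact_mod_cast Real.pi_ne_zero
  rw [thetaPrim, Y₁]
  refine tsum_congr fun k => ?_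
  rw [pow_one]
  congr 2
  rcases eq_or_ne b 0 with rfl | hb
  · simp
  · have hb' : (b : ℂ) ≠ 0 := by exact_mod_cast hb
    field_simp

theorem hasSum_thetaPrim (m : ℕ) (x : ℝ) :
    HasSum (fun k : ℕ => Complex.exp (Real.pi * Complex.I * ((k : ℂ) + 1) ^ 2 * x) /
      (((k : ℂ) + 1) ^ 2) ^ (m + 1)) (thetaPrim (m + 1) x) :=
  (Summable.of_norm_bounded hasSum_inv_add_one_sq.summable
    fun k => norm_thetaPrim_term_le m k (by simp)).hasSum

/-- The terms k and -k coincide, and 1/12 is 2/(4π²) times ∑ 1/k² = π²/6. -/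
theorem riemannPhi_eq (t : ℝ) :
    riemannPhi t = Complex.I * t - thetaPrim 1 (-(4 * Real.pi * t)) / (2 * Real.pi ^ 2) + 1 / 12 := by
  have hpi : (Real.pi : ℂ) ≠ 0 := by exact_mod_cast Real.pi_ne_zero
  have h1 := hasSum_thetaPrim 0 (-(4 * Real.pi * t))
  have h2 : HasSum (fun k : ℕ => 1 / ((k : ℂ) + 1) ^ 2) ((Real.pi : ℂ) ^ 2 / 6) := by
    have := Complex.hasSum_ofReal.2 hasSum_inv_add_one_sq
    push_cast at this
    exact this
  have h3 := (h1.sub h2).div_const (-4 * (Real.pi : ℂ) ^ 2)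
  have key : ∀ k : ℕ, (Complex.exp (Real.pi * Complex.I * ((k : ℂ) + 1) ^ 2 *
      ((-(4 * Real.pi * t) : ℝ) : ℂ)) / (((k : ℂ) + 1) ^ 2) ^ (0 + 1) - 1 / ((k : ℂ) + 1) ^ 2) /
        (-4 * (Real.pi : ℂ) ^ 2) =
      (Complex.exp (-4 * (Real.pi : ℂ) ^ 2 * Complex.I * ((k : ℂ) + 1) ^ 2 * (t : ℂ)) - 1) /
        (-4 * (Real.pi : ℂ) ^ 2 * ((k : ℂ) + 1) ^ 2) := by
    intro k
    have hk : ((k : ℂ) + 1) ≠ 0 := Nat.cast_add_one_ne_zero k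
    have : Real.pi * Complex.I * ((k : ℂ) + 1) ^ 2 * ((-(4 * Real.pi * t) : ℝ) : ℂ)
      = -4 * (Real.pi : ℂ) ^ 2 * Complex.I * ((k : ℂ) + 1) ^ 2 * (t : ℂ) := by push_cast; ring
    rw [this, zero_add, pow_one]
    field_simp
  simp only [key] at h3
  have hk1 : ∀ k : ℕ, ((k : ℤ) + 1) ≠ 0 := fun k => by omega
  have hk2 : ∀ k : ℕ, (-((k : ℤ) + 1)) ≠ 0 := fun k => by omega
  have h4 := HasSum.of_add_one_of_neg_add_one (f := fun k : ℤ => if k = 0 then Complex.I * (t : ℂ) else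
    (Complex.exp (-4 * (Real.pi : ℂ) ^ 2 * Complex.I * (k : ℂ) ^ 2 * (t : ℂ)) - 1) /
      (-4 * (Real.pi : ℂ) ^ 2 * (k : ℂ) ^ 2))
    (by simp only [if_neg (hk1 _)]; push_cast; exact h3)
    (by simp only [if_neg (hk2 _)]; push_cast; simp only [neg_sq]; exact h3)
  rw [riemannPhi, h4.tsum_eq]
  simp only [if_true, zero_add]
  push_cast
  field_simp
  ring

theorem riemannPhi_sub (t h : ℝ) :
    riemannPhi (t + h) - riemannPhi t = Complex.I / (4 * Real.pi) *
      conj (thetaInt (((4 * Real.pi * t : ℝ) : ℂ) + ((4 * Real.pi * h : ℝ) : ℂ))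
        - thetaInt ((4 * Real.pi * t : ℝ) : ℂ)) := by
  have hpi : (Real.pi : ℂ) ≠ 0 := by exact_mod_cast Real.pi_ne_zero
  have hI := Complex.I_ne_zero
  rw [riemannPhi_eq, riemannPhi_eq, ← Complex.ofReal_add, thetaInt, thetaInt]
  simp only [map_sub, map_add, map_mul, map_div₀, conj_thetaPrim, Complex.conj_ofReal,
    Complex.conj_I, map_ofNat]
  have e1 : (-((4 * Real.pi * t + 4 * Real.pi * h : ℝ) : ℂ)) = -(4 * Real.pi * ((t + h : ℝ) : ℂ)) := by
    push_cast; ring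
  have e2 : (-((4 * Real.pi * t : ℝ) : ℂ)) = -(4 * Real.pi * (t : ℂ)) := by push_cast; ring
  rw [e1, e2]
  push_cast
  field_simp
  ring

theorem sqrtBranch_sq (h : ℝ) : sqrtBranch h ^ 2 = h := by
  unfold sqrtBranch
  split_ifs with h0
  · rw [← Complex.ofReal_pow, Real.sq_sqrt h0]
  · rw [mul_pow, ← Complex.ofReal_pow, Real.sq_sqrt (by linarith), neg_sq, Complex.I_sq]
    push_cast; ring

theorem norm_sqrtBranch (h : ℝ) : ‖sqrtBranch h‖ = √|h| := by
  rw [eq_comm, Real.sqrt_eq_iff_mul_self_eq (abs_nonneg _) (norm_nonneg _), ← pow_two, ← norm_pow,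
    sqrtBranch_sq, Complex.norm_real, Real.norm_eq_abs]

theorem sqrtBranch_mul {a : ℝ} (ha : 0 < a) (h : ℝ) :
    sqrtBranch (a * h) = ((√a : ℝ) : ℂ) * sqrtBranch h := by
  unfold sqrtBranch
  simp only [mul_nonneg_iff_of_pos_left ha]
  split_ifs with h0
  · rw [Real.sqrt_mul ha.le]; push_cast; ring
  · rw [← mul_neg, Real.sqrt_mul ha.le]; push_cast; ring

theorem one_add_I_div_sqrt_two_sq : ((1 + Complex.I) / ((√2 : ℝ) : ℂ)) ^ 2 = Complex.I := by
  rw [div_pow, ← Complex.ofReal_pow, Real.sq_sqrt (by norm_num)]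
  push_cast
  linear_combination Complex.I_sq / 2

theorem norm_one_add_I_div_sqrt_two : ‖(1 + Complex.I) / ((√2 : ℝ) : ℂ)‖ = 1 := by
  have : ‖(1 + Complex.I) / ((√2 : ℝ) : ℂ)‖ ^ 2 = 1 := by
    rw [← norm_pow, one_add_I_div_sqrt_two_sq, Complex.norm_I]
  exact (pow_eq_one_iff_of_nonneg (norm_nonneg _) two_ne_zero).1 this

/-- Both sides have the same square, and the conjugate of the right side has positive real part,
which singles out the principal root. This is where the branch √(-1) = -i is forced. -/
theorem conj_cuspRoot {q : ℝ} (hq : 0 < q) {w : ℝ} (hw : w ≠ 0) :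
    conj (cuspRoot q w) = (1 + Complex.I) / ((√2 : ℝ) : ℂ) * ((√q : ℝ) : ℂ) * sqrtBranch w := by
  set r : ℂ := (1 + Complex.I) / ((√2 : ℝ) : ℂ) * ((√q : ℝ) : ℂ) * sqrtBranch w
  have hr2 : (conj r) ^ 2 = -Complex.I * (q * w) := by
    rw [← map_pow]
    simp only [r]
    rw [mul_pow, mul_pow, one_add_I_div_sqrt_two_sq, sqrtBranch_sq, ← Complex.ofReal_pow,
      Real.sq_sqrt hq.le]
    simp [mul_assoc]
  have hre : 0 < (conj r).re := by
    rw [Complex.conj_re]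
    have h2 : 0 < √2 := by positivity
    have hq' : 0 < √q := Real.sqrt_pos.2 hq
    simp only [r, sqrtBranch]
    split_ifs with h0
    · have : (1 + Complex.I) / ((√2 : ℝ) : ℂ) * ((√q : ℝ) : ℂ) * ((√w : ℝ) : ℂ)
        = ((√q * √w / √2 : ℝ) : ℂ) * (1 + Complex.I) := by push_cast; ring
      rw [this, Complex.re_ofReal_mul]
      have : 0 < √w := Real.sqrt_pos.2 (lt_of_le_of_ne h0 hw.symm)
      simp; positivity
    · have : (1 + Complex.I) / ((√2 : ℝ) : ℂ) * ((√q : ℝ) : ℂ) * (-Complex.I * ((√(-w) : ℝ) : ℂ))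
        = ((√q * √(-w) / √2 : ℝ) : ℂ) * (1 - Complex.I) := by
        push_cast
        linear_combination (-(((√q : ℝ) : ℂ) * ((√(-w) : ℝ) : ℂ) / ((√2 : ℝ) : ℂ))) * Complex.I_sq
      rw [this, Complex.re_ofReal_mul]
      have : 0 < √(-w) := Real.sqrt_pos.2 (by linarith)
      simp; positivity
  rw [cuspRoot, ← hr2, one_div, Complex.sq_cpow_two_inv hre, Complex.conj_conj]

/-- Principal expansion of `φ` near a cusp, for an abstract cusp of width `q²`. -/
theorem riemannPhi_expansion {q κ t : ℝ} (hq : 0 < q) {e : ℂ} (he : ‖e‖ = 1)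
    (hid : ∀ z : ℂ, 0 < z.im → jacobiTheta (cuspMap q κ (z - ((4 * Real.pi * t : ℝ) : ℂ))) =
      e * cuspRoot q (z - ((4 * Real.pi * t : ℝ) : ℂ)) * jacobiTheta z)
    (h : ℝ) {Y : ℂ} (hY : h ≠ 0 → Y = thetaPrim 1 (κ + 1 / (q ^ 2 * (4 * Real.pi * h)))) :
    ∃ R : ℂ, ‖R‖ ≤ 88 * Real.pi ^ 2 * (q ^ 3 * √q * (h ^ 2 * √|h|)) ∧
      riemannPhi (t + h) - riemannPhi t =
        e / ((√Real.pi : ℝ) : ℂ) * ((1 + Complex.I) / ((√2 : ℝ) : ℂ)) *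
          (sqrtBranch h / ((√q : ℝ) : ℂ)
            + 4 * Complex.I * Y * ((q * √q : ℝ) : ℂ) * sqrtBranch h ^ 3 + R) := by
  rcases eq_or_ne h 0 with rfl | hh
  -- At h = 0 the factor h^{3/2} vanishes, whatever Y is.
  · exact ⟨0, by simp, by simp [sqrtBranch]⟩
  have hpi : (Real.pi : ℂ) ≠ 0 := by exact_mod_cast Real.pi_ne_zero
  have hq0 : (q : ℂ) ≠ 0 := by exact_mod_cast hq.ne'
  have h4pi : 0 < 4 * Real.pi := by positivity
  set w : ℝ := 4 * Real.pi * h with hw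
  have hw0 : w ≠ 0 := mul_ne_zero h4pi.ne' hh
  have hbound := norm_thetaInt_sub_cuspExpansion_le hq he hid hw0
  set E := thetaInt (((4 * Real.pi * t : ℝ) : ℂ) + (w : ℂ)) - thetaInt ((4 * Real.pi * t : ℝ) : ℂ)
    - e⁻¹ * cuspExpansion q κ w with hE
  have hbound2 := norm_thetaPrim_two_term_le (κ := κ) hq (w := (w : ℂ)) (by simp)
  set T := 3 * (q : ℂ) ^ 4 / (Real.pi : ℂ) ^ 2 * (w : ℂ) ^ 2 * thetaPrim 2 (cuspMap q κ w) with hT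
  set ω := (1 + Complex.I) / ((√2 : ℝ) : ℂ) with hω
  have hω1 : ‖ω‖ = 1 := norm_one_add_I_div_sqrt_two
  have hω0 : ω ≠ 0 := fun h => by simp [h] at hω1
  have he0 : e ≠ 0 := fun h => by simp [h] at he
  have hsp : 0 < √Real.pi := Real.sqrt_pos.2 Real.pi_pos
  have hsq : 0 < √q := Real.sqrt_pos.2 hq
  have hsp0 : ((√Real.pi : ℝ) : ℂ) ≠ 0 := by exact_mod_cast hsp.ne'
  have hsq0 : ((√q : ℝ) : ℂ) ≠ 0 := by exact_mod_cast hsq.ne'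
  have hsp2 : ((√Real.pi : ℝ) : ℂ) ^ 2 = Real.pi := by
    rw [← Complex.ofReal_pow, Real.sq_sqrt Real.pi_pos.le]
  have hsq2 : ((√q : ℝ) : ℂ) ^ 2 = q := by rw [← Complex.ofReal_pow, Real.sq_sqrt hq.le]
  have hs4 : √(4 * Real.pi) = 2 * √Real.pi := by
    rw [Real.sqrt_mul (by norm_num), show (4 : ℝ) = 2 ^ 2 by norm_num, Real.sqrt_sq (by norm_num)]
  have hexp : conj (cuspExpansion q κ w) = -Complex.I / q *
      (ω * ((√q : ℝ) : ℂ) * (2 * ((√Real.pi : ℝ) : ℂ) * sqrtBranch h)) *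
      (2 + 2 * ((q : ℂ) ^ 2 * Complex.I / Real.pi) * (4 * Real.pi * h) * Y + conj T) := by
    have hY' : conj (thetaPrim 1 (cuspMap q κ w)) = Y := by
      have : cuspMap q κ w = ((-κ - 1 / (q ^ 2 * w) : ℝ) : ℂ) := by
        rw [cuspMap]; push_cast; ring
      rw [this, conj_thetaPrim, hY hh]
      congr 1
      rw [hw]; push_cast; ring
    rw [cuspExpansion, ← hT]
    simp only [map_mul, map_add, map_div₀, map_pow, Complex.conj_ofReal, Complex.conj_I, map_ofNat]
    rw [conj_cuspRoot hq hw0, hY', hw, sqrtBranch_mul h4pi, hs4, ← hω]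
    push_cast
    have : (q : ℂ) ^ 2 / (Real.pi * -Complex.I) = (q : ℂ) ^ 2 * Complex.I / Real.pi := by
      have := Complex.I_ne_zero
      field_simp
      rw [Complex.I_sq]
    rw [this]
  have hconj : conj e⁻¹ = e := by rw [Complex.inv_eq_conj he, Complex.conj_conj]
  have hcube : sqrtBranch h ^ 3 = h * sqrtBranch h := by rw [← sqrtBranch_sq h]; ring
  -- The remainder joins the `thetaPrim 2` term of the expansion, at most 8π² times the error scale,
  -- and the integration error, at most 80π² times it.
  refine ⟨sqrtBranch h / ((√q : ℝ) : ℂ) * (conj T / 2)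
    + ((√Real.pi : ℝ) : ℂ) / (e * ω) * (Complex.I / (4 * Real.pi) * conj E), ?_, ?_⟩
  · have hn1 : ‖sqrtBranch h / ((√q : ℝ) : ℂ) * (conj T / 2)‖
        ≤ 8 * Real.pi ^ 2 * (q ^ 3 * √q * (h ^ 2 * √|h|)) := by
      rw [norm_mul, norm_div, norm_div, RCLike.norm_conj, norm_sqrtBranch, Complex.norm_real,
        Real.norm_of_nonneg hsq.le, Complex.norm_ofNat]
      calc √|h| / √q * (‖T‖ / 2) ≤ √|h| / √q * ((q ^ 4 * ‖(w : ℂ)‖ ^ 2) / 2) := by gcongr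
        _ = √|h| / √q * ((q ^ 3 * (√q * √q) * w ^ 2) / 2) := by
          rw [Complex.norm_real, Real.norm_eq_abs, sq_abs, Real.mul_self_sqrt hq.le]; ring
        _ = _ := by rw [hw]; field_simp; ring
    have hn2 : ‖((√Real.pi : ℝ) : ℂ) / (e * ω) * (Complex.I / (4 * Real.pi) * conj E)‖
        ≤ 80 * Real.pi ^ 2 * (q ^ 3 * √q * (h ^ 2 * √|h|)) := by
      have hx : ‖((√Real.pi : ℝ) : ℂ) / (e * ω) * (Complex.I / (4 * Real.pi) * conj E)‖
          = √Real.pi / (4 * Real.pi) * ‖E‖ := by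
        simp only [norm_mul, norm_div, RCLike.norm_conj, he, hω1, Complex.norm_real,
          Real.norm_of_nonneg hsp.le, Real.norm_of_nonneg Real.pi_pos.le, Complex.norm_ofNat,
          Complex.norm_I]
        ring
      have hsw : √|w| = 2 * √Real.pi * √|h| := by
        rw [hw, abs_mul, abs_of_pos h4pi, Real.sqrt_mul h4pi.le, hs4]
      rw [hx]
      calc _ ≤ √Real.pi / (4 * Real.pi) * (10 * q ^ 3 * √q * (w ^ 2 * √|w|)) := by gcongr
        _ = 80 * Real.pi * (√Real.pi * √Real.pi) * (q ^ 3 * √q * (h ^ 2 * √|h|)) := by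
          rw [hsw, hw]; field_simp; ring
        _ = _ := by rw [Real.mul_self_sqrt Real.pi_pos.le]; ring
    refine (norm_add_le _ _).trans ((add_le_add hn1 hn2).trans_eq (by ring))
  · have hmain : thetaInt (((4 * Real.pi * t : ℝ) : ℂ) + (w : ℂ))
        - thetaInt ((4 * Real.pi * t : ℝ) : ℂ) = E + e⁻¹ * cuspExpansion q κ w := by rw [hE]; ring
    rw [riemannPhi_sub, hmain, map_add, map_mul, hconj, hexp, hcube]
    generalize conj E = E'
    generalize conj T = T'
    generalize sqrtBranch h = s
    push_cast
    rw [← hsp2, ← hsq2]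
    generalize ((√q : ℝ) : ℂ) = a at *
    generalize ((√Real.pi : ℝ) : ℂ) = b at *
    generalize ω = o at *
    have hI2 := Complex.I_sq
    have hI3 : Complex.I ^ 3 = -Complex.I := Complex.I_pow_three
    field_simp
    ring_nf
    simp only [hI2, hI3]
    ring
end

/-! ### Self-similarity and assembly -/

/-- `riemannPhi_eq` solved for `thetaPrim 1` at t = -1/(16π²b); its linear term it becomes the term
in 1/b. -/
theorem Y₁_eq_riemannPhi (b : ℝ) :
    Y₁ b = (Real.pi : ℂ) ^ 2 * (1 / 6 - 2 * riemannPhi (-1 / (16 * Real.pi ^ 2 * b)))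
      - Complex.I / 8 * (1 / (b : ℂ)) := by
  have hpi : (Real.pi : ℂ) ≠ 0 := by exact_mod_cast Real.pi_ne_zero
  rw [Y₁_eq, riemannPhi_eq]
  have harg : -(4 * Real.pi * ((-1 / (16 * Real.pi ^ 2 * b) : ℝ) : ℂ)) = 1 / (4 * Real.pi * b) := by
    rcases eq_or_ne b 0 with rfl | hb
    · simp
    · have hb' : (b : ℂ) ≠ 0 := by exact_mod_cast hb
      push_cast; field_simp; norm_num
  rw [harg]
  rcases eq_or_ne b 0 with rfl | hb
  · simp; field_simp; ring
  · have hb' : (b : ℂ) ≠ 0 := by exact_mod_cast hb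
    push_cast; field_simp; ring

/-- Explains the choice of b: 1/(4πb(h)) is minus the image under `cuspMap` of 4πh, with κ = c_±/q̃.
-/
theorem inv_bScale {p q : ℕ} (hq : 0 < qTilde p q) (cp cm : ℤ) {h : ℝ} (hh : h ≠ 0) :
    1 / bScale p q cp cm h =
      1 / ((qTilde p q : ℝ) ^ 2 * h) + 4 * Real.pi * (cPM cp cm h / (qTilde p q : ℝ)) := by
  have hQ : (qTilde p q : ℝ) ≠ 0 := by exact_mod_cast hq.ne'
  rw [bScale, one_div_div]
  field_simp

/-- The transformation law at the cusp `2p/q`, uniformly in the admissible lower coefficient. -/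
theorem exists_jacobiTheta_tilde {p q : ℕ} (hq : 0 < qTilde p q)
    (hcop : IsCoprime (qTilde p q : ℤ) (pTilde p q))
    (hodd : Odd ((qTilde p q : ℤ) + pTilde p q)) :
    ∃ e : ℂ, e ^ 8 = 1 ∧ ∀ c : ℤ, IsLowerCoeff p q c → ∀ z : ℂ, 0 < z.im →
      jacobiTheta (cuspMap (qTilde p q) ((c : ℝ) / (qTilde p q : ℝ))
        (z - ((pTilde p q / qTilde p q : ℝ) : ℂ))) =
      e * cuspRoot (qTilde p q) (z - ((pTilde p q / qTilde p q : ℝ) : ℂ)) * jacobiTheta z := by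
  obtain ⟨c₀, hc₀, -⟩ := exists_isLowerCoeff_mem_Ico hq hcop hodd 0
  obtain ⟨d, h1, h2, h3, -⟩ := isLowerCoeff_iff.1 hc₀
  have hQ : (qTilde p q : ℂ) ≠ 0 := by exact_mod_cast hq.ne'
  simp only [Int.ModEq] at h2 h3
  rw [Int.odd_iff] at hodd
  obtain ⟨e, he, hid⟩ := jacobiTheta_cusp (Int.natCast_pos.2 hq) h1
    (by rw [Int.odd_iff]; omega) (by rw [Int.odd_iff]; omega)
  refine ⟨e, he, fun c hc z hz => ?_⟩
  -- Passing to another admissible c translates the image by -2k, which θ does not see; so the same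
  -- e serves all c.
  obtain ⟨k, rfl⟩ := hc₀.exists_sub_eq hq hc
  have hz' := hid z hz
  push_cast at hz'
  have hmul : (qTilde p q : ℂ) * (z - pTilde p q / qTilde p q) = qTilde p q * z - pTilde p q := by
    field_simp
  simp only [cuspMap, cuspRoot]
  push_cast
  rw [pow_two, mul_assoc, hmul, ← hz', ← jacobiTheta_add_two_mul_int _ k]
  congr 1
  field_simp
  ring

theorem rpow_halves {x : ℝ} (hx : 0 ≤ x) :
    x ^ (1 / 2 : ℝ) = √x ∧ x ^ (3 / 2 : ℝ) = x * √x ∧ x ^ (5 / 2 : ℝ) = x ^ 2 * √x ∧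
      x ^ (7 / 2 : ℝ) = x ^ 3 * √x := by
  refine ⟨(Real.sqrt_eq_rpow x).symm, ?_, ?_, ?_⟩
  · rw [Real.sqrt_eq_rpow, ← Real.rpow_one_add' hx (by norm_num)]; norm_num
  · rw [Real.sqrt_eq_rpow, ← Real.rpow_natCast, ← Real.rpow_add' hx (by norm_num)]; norm_num
  · rw [Real.sqrt_eq_rpow, ← Real.rpow_natCast, ← Real.rpow_add' hx (by norm_num)]; norm_num

theorem cPM_div (cp cm : ℤ) (h : ℝ) {a : ℝ} (ha : 0 < a) : cPM cp cm (h / a) = cPM cp cm h := by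
  simp only [cPM, le_div_iff₀ ha, zero_mul]

theorem sqrtBranch_div_sq (h : ℝ) {a : ℝ} (ha : 0 < a) :
    sqrtBranch (h / a ^ 2) = sqrtBranch h / a := by
  rw [div_eq_inv_mul, sqrtBranch_mul (by positivity), ← inv_pow, Real.sqrt_sq (by positivity)]
  push_cast
  rw [div_eq_inv_mul]

theorem mainTheorem5 :
    ∃ C : ℝ, 0 < C ∧ ∀ p q : ℕ, p < q → Nat.gcd p q = 1 →
      (q % 4 = 0 ∨ q % 4 = 1 ∨ q % 4 = 3) →
      (∃ cp : ℤ, IsCPlus p q cp) ∧ (∃ cm : ℤ, IsCMinus p q cm) ∧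
      ∃ e : ℂ, e ^ 8 = 1 ∧ ∀ cp cm : ℤ, IsCPlus p q cp → IsCMinus p q cm →
        -- principal form
        (∀ h : ℝ,
          |h| ≤ 1 / (4 * Real.pi * (|cPM cp cm h| / (qTilde p q : ℝ)) * (qTilde p q : ℝ) ^ 2) →
          ∃ R : ℂ, ‖R‖ ≤ C * ((qTilde p q : ℝ) ^ (7 / 2 : ℝ) * |h| ^ (5 / 2 : ℝ)) ∧
            riemannPhi (tRat p q + h) - riemannPhi (tRat p q) =
              e / ((Real.sqrt Real.pi : ℝ) : ℂ) * ((1 + Complex.I) / ((Real.sqrt 2 : ℝ) : ℂ)) *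
                (sqrtBranch h / (((qTilde p q : ℝ) ^ (1 / 2 : ℝ) : ℝ) : ℂ)
                  + 4 * Complex.I * Y₁ (bScale p q cp cm h)
                    * (((qTilde p q : ℝ) ^ (3 / 2 : ℝ) : ℝ) : ℂ) * sqrtBranch h ^ 3
                  + R)) ∧
        -- self-similar form
        (∀ h : ℝ,
          |h| ≤ 1 / (4 * Real.pi * (|cPM cp cm h| / (qTilde p q : ℝ)) * (qTilde p q : ℝ) ^ 2) →
          ∃ R : ℂ, ‖R‖ ≤ C * ((qTilde p q : ℝ) ^ (7 / 2 : ℝ) * |h| ^ (5 / 2 : ℝ)) ∧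
            riemannPhi (tRat p q + h) - riemannPhi (tRat p q) =
              3 / 2 * (e / ((Real.sqrt Real.pi : ℝ) : ℂ)) *
                ((1 + Complex.I) / ((Real.sqrt 2 : ℝ) : ℂ)) *
                (sqrtBranch h / (((qTilde p q : ℝ) ^ (1 / 2 : ℝ) : ℝ) : ℂ)
                  + 8 * (Real.pi : ℂ) ^ 2 / 3 * Complex.I *
                    (1 / 6 - Complex.I / (2 * (Real.pi : ℂ)) *
                        ((cPM cp cm h / (qTilde p q : ℝ) : ℝ) : ℂ)
                      - 2 * riemannPhi (-1 / (16 * Real.pi ^ 2 * bScale p q cp cm h)))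
                    * (((qTilde p q : ℝ) ^ (3 / 2 : ℝ) : ℝ) : ℂ) * sqrtBranch h ^ 3
                  + R)) ∧
        -- rescaled self-similar form
        (∀ h : ℝ,
          |h| ≤ 1 / (4 * Real.pi * (|cPM cp cm h| / (qTilde p q : ℝ))) →
          ∃ R : ℂ, ‖R‖ ≤ C * |h| ^ (5 / 2 : ℝ) ∧
            riemannPhi (tRat p q + h / (qTilde p q : ℝ) ^ 2) - riemannPhi (tRat p q) =
              3 / (2 * ((Real.sqrt Real.pi : ℝ) : ℂ)) *
                ((1 + Complex.I) / ((Real.sqrt 2 : ℝ) : ℂ)) *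
                (e / (((qTilde p q : ℝ) ^ (3 / 2 : ℝ) : ℝ) : ℂ)) *
                (sqrtBranch h
                  + 8 * (Real.pi : ℂ) ^ 2 / 3 * Complex.I *
                    (1 / 6 - Complex.I / (2 * (Real.pi : ℂ)) *
                        ((cPM cp cm h / (qTilde p q : ℝ) : ℝ) : ℂ)
                      - 2 * riemannPhi (-1 / (16 * Real.pi ^ 2 * betaScale p q cp cm h)))
                    * sqrtBranch h ^ 3
                  + R)) := by
  refine ⟨88 * Real.pi ^ 2, by positivity, fun p q hpq hgcd hmod => ?_⟩
  obtain ⟨hq, hcop, hodd, hdiv⟩ := tilde_spec hpq hgcd hmod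
  refine ⟨?_, ?_, ?_⟩
  · obtain ⟨c, hc, h1, h2⟩ := exists_isLowerCoeff_mem_Ico hq hcop hodd (qTilde p q)
    exact ⟨c, hc, h1, by linarith⟩
  · obtain ⟨c, hc, h1, h2⟩ := exists_isLowerCoeff_mem_Ico hq hcop hodd (-(4 * (qTilde p q : ℤ)))
    exact ⟨c, hc, h1, by linarith⟩
  obtain ⟨e, he, hid⟩ := exists_jacobiTheta_tilde hq hcop hodd
  refine ⟨e, he, fun cp cm hcp hcm => ?_⟩
  have he1 : ‖e‖ = 1 := Complex.norm_eq_one_of_pow_eq_one he (by norm_num)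
  have hQ : 0 < (qTilde p q : ℝ) := by exact_mod_cast hq
  have hsQ : 0 < √(qTilde p q : ℝ) := Real.sqrt_pos.2 hQ
  have hpi : (Real.pi : ℂ) ≠ 0 := by exact_mod_cast Real.pi_ne_zero
  have ht : 4 * Real.pi * tRat p q = pTilde p q / qTilde p q := by
    have := Real.pi_ne_zero
    rw [hdiv, tRat]; field_simp; ring
  obtain ⟨hr1, hr3, -, hr7⟩ := rpow_halves hQ.le
  have principal : ∀ h : ℝ, ∃ R : ℂ,
      ‖R‖ ≤ 88 * Real.pi ^ 2 * ((qTilde p q : ℝ) ^ (7 / 2 : ℝ) * |h| ^ (5 / 2 : ℝ)) ∧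
      riemannPhi (tRat p q + h) - riemannPhi (tRat p q) =
        e / ((Real.sqrt Real.pi : ℝ) : ℂ) * ((1 + Complex.I) / ((Real.sqrt 2 : ℝ) : ℂ)) *
          (sqrtBranch h / (((qTilde p q : ℝ) ^ (1 / 2 : ℝ) : ℝ) : ℂ)
            + 4 * Complex.I * Y₁ (bScale p q cp cm h)
              * (((qTilde p q : ℝ) ^ (3 / 2 : ℝ) : ℝ) : ℂ) * sqrtBranch h ^ 3 + R) := by
    intro h
    have hc : ∃ c : ℤ, IsLowerCoeff p q c ∧ cPM cp cm h = c := by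
      unfold cPM
      split_ifs
      exacts [⟨cp, hcp.1, rfl⟩, ⟨cm, hcm.1, rfl⟩]
    obtain ⟨c, hc, hcc⟩ := hc
    rw [hr1, hr3, hr7, (rpow_halves (abs_nonneg h)).2.2.1, sq_abs]
    refine riemannPhi_expansion (κ := (c : ℝ) / (qTilde p q : ℝ)) hQ he1
      (by rw [ht]; exact hid c hc) h fun hh => ?_
    rw [Y₁_eq]
    congr 1
    have h1 := congrArg (fun x : ℝ => (x : ℂ)) (inv_bScale hq cp cm hh)
    rw [hcc] at h1
    have hQ' : (qTilde p q : ℂ) ≠ 0 := by exact_mod_cast hq.ne'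
    have hh' : (h : ℂ) ≠ 0 := by exact_mod_cast hh
    push_cast at h1 ⊢
    rw [one_div, mul_inv, ← one_div (bScale p q cp cm h : ℂ), h1]
    field_simp
    ring
  have selfsim : ∀ h : ℝ, ∃ R : ℂ,
      ‖R‖ ≤ 88 * Real.pi ^ 2 * ((qTilde p q : ℝ) ^ (7 / 2 : ℝ) * |h| ^ (5 / 2 : ℝ)) ∧
      riemannPhi (tRat p q + h) - riemannPhi (tRat p q) =
        3 / 2 * (e / ((Real.sqrt Real.pi : ℝ) : ℂ)) *
          ((1 + Complex.I) / ((Real.sqrt 2 : ℝ) : ℂ)) *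
          (sqrtBranch h / (((qTilde p q : ℝ) ^ (1 / 2 : ℝ) : ℝ) : ℂ)
            + 8 * (Real.pi : ℂ) ^ 2 / 3 * Complex.I *
              (1 / 6 - Complex.I / (2 * (Real.pi : ℂ)) *
                  ((cPM cp cm h / (qTilde p q : ℝ) : ℝ) : ℂ)
                - 2 * riemannPhi (-1 / (16 * Real.pi ^ 2 * bScale p q cp cm h)))
              * (((qTilde p q : ℝ) ^ (3 / 2 : ℝ) : ℝ) : ℂ) * sqrtBranch h ^ 3 + R) := by
    intro h
    obtain ⟨R, hR, heq⟩ := principal h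
    -- The prefactor 3/2 is now outside the bracket.
    refine ⟨2 / 3 * R, ?_, ?_⟩
    · rw [norm_mul]
      have : ‖(2 / 3 : ℂ)‖ = 2 / 3 := by norm_num
      rw [this]
      linarith [norm_nonneg R]
    · rw [heq]
      rcases eq_or_ne h 0 with rfl | hh
      · simp [sqrtBranch]; ring
      have h1 := congrArg (fun x : ℝ => (x : ℂ)) (inv_bScale hq cp cm hh)
      have hcube : sqrtBranch h ^ 3 = h * sqrtBranch h := by rw [← sqrtBranch_sq h]; ring
      have hQ2 : (qTilde p q : ℂ) = ((√(qTilde p q : ℝ) : ℝ) : ℂ) ^ 2 := by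
        rw [← Complex.ofReal_pow, Real.sq_sqrt hQ.le]; simp
      have hsQ0 : ((√(qTilde p q : ℝ) : ℝ) : ℂ) ≠ 0 := by exact_mod_cast hsQ.ne'
      have hh' : (h : ℂ) ≠ 0 := by exact_mod_cast hh
      rw [Y₁_eq_riemannPhi, hcube, hr1, hr3]
      push_cast at h1 ⊢
      rw [h1]
      generalize riemannPhi _ = F
      rw [hQ2]
      generalize ((√(qTilde p q : ℝ) : ℝ) : ℂ) = a at *
      generalize (cPM cp cm h : ℂ) = c at *
      generalize sqrtBranch h = s at *
      rw [show 3 / 2 * (e / ((√Real.pi : ℝ) : ℂ)) * ((1 + Complex.I) / ((√2 : ℝ) : ℂ))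
        = e / ((√Real.pi : ℝ) : ℂ) * ((1 + Complex.I) / ((√2 : ℝ) : ℂ)) * (3 / 2) by ring,
        mul_assoc (e / ((√Real.pi : ℝ) : ℂ) * ((1 + Complex.I) / ((√2 : ℝ) : ℂ)))]
      congr 1
      have hI2 := Complex.I_sq
      field_simp
      ring_nf
      simp only [hI2]
      ring
  refine ⟨fun h _ => principal h, fun h _ => selfsim h, fun h _ => ?_⟩
  obtain ⟨R, hR, heq⟩ := selfsim (h / (qTilde p q : ℝ) ^ 2)
  have hQ2 : 0 < (qTilde p q : ℝ) ^ 2 := by positivity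
  have hsQ0 : ((√(qTilde p q : ℝ) : ℝ) : ℂ) ≠ 0 := by exact_mod_cast hsQ.ne'
  rw [hr1, hr3, cPM_div _ _ _ hQ2, sqrtBranch_div_sq h hQ] at heq
  rw [hr7, (rpow_halves (abs_nonneg _)).2.2.1, abs_div, abs_of_pos hQ2, Real.sqrt_div (abs_nonneg h),
    Real.sqrt_sq hQ.le] at hR
  -- Extracting q̃^{-3/2} from the bracket multiplies the remainder by q̃^{3/2}; with q̃^{7/2} and
  -- |h/q̃²|^{5/2} all powers of q̃ cancel.
  refine ⟨R * ((qTilde p q * √(qTilde p q : ℝ) : ℝ) : ℂ), ?_, ?_⟩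
  · rw [norm_mul, Complex.norm_real, Real.norm_of_nonneg (by positivity),
      (rpow_halves (abs_nonneg h)).2.2.1]
    calc _ ≤ 88 * Real.pi ^ 2 * ((qTilde p q : ℝ) ^ 3 * √(qTilde p q : ℝ) *
          ((|h| / (qTilde p q : ℝ) ^ 2) ^ 2 * (√|h| / qTilde p q))) *
            (qTilde p q * √(qTilde p q : ℝ)) := by gcongr
      _ = 88 * Real.pi ^ 2 * (|h| ^ 2 * √|h|) * (√(qTilde p q : ℝ) ^ 2 / qTilde p q) := by
        field_simp
      _ = _ := by rw [Real.sq_sqrt hQ.le, div_self hQ.ne', mul_one]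
  · rw [heq, hr3, betaScale]
    have hQ3 : (qTilde p q : ℂ) = ((√(qTilde p q : ℝ) : ℝ) : ℂ) ^ 2 := by
      rw [← Complex.ofReal_pow, Real.sq_sqrt hQ.le]; simp
    generalize riemannPhi _ = F
    generalize cPM cp cm h = c
    generalize sqrtBranch h = s
    push_cast
    rw [hQ3]
    generalize ((√(qTilde p q : ℝ) : ℝ) : ℂ) = a at *
    field_simp
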